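/- Let $n\ge 1$, $\lambda\in(0,1)$ and let $p\ge 1$ be a real number with Hölder conjugate $q$, i.e. $1/p+1/q=1$ (for $p=1$ the powers $(1-\mu)^{1/q}$ and $\mu^{1/q}$ are read as $1$ for all $\mu\in[0,1]$). Notation. For $a,b\ge 0$, coefficients $t,s\ge 0$ and $\alpha\in[-\infty,\infty]\setminus\{0\}$ put $\mathcal S_\alpha^{t,s}(a,b)=0$ if $ab=0$; if $ab>0$, put $\mathcal S_\alpha^{t,s}(a,b)=(ta^\alpha+sb^\alpha)^{1/\alpha}$ for $\alpha$ real, $\mathcal S_\infty^{t,s}(a,b)=\max\{a,b\}$ and $\mathcal S_{-\infty}^{t,s}(a,b)=\min\{a,b\}$. Put $\mathcal M_\alpha^\lambda(a,b)=\mathcal S_\alpha^{1-\lambda,\lambda}(a,b)$ for $\alpha\ne 0$ and $\mathcal M_0^\lambda(a,b)=a^{1-\lambda}b^\lambda$. The expression $\frac{p\alpha}{n\alpha+1}$ is read as $-\infty$ for $\alpha=-1/n$ and as $p/n$ for $\alpha=\infty$. For $K,L\subset\mathbb R^n$ let $$M_p=(1-\lambda)\cdot K+_p\lambda\cdot L=\bigl\{(1-\lambda)^{1/p}(1-\mu)^{1/q}x+\lambda^{1/p}\mu^{1/q}y:\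 x\in K,\ y\in L,\ \mu\in[0,1]\bigr\}.$$ Corollary (discrete $L_p$ Borell–Brascamp–Lieb inequality for lattices). Let $K,L\subset\mathbb R^n$ be non-empty bounded sets, let $-1/n\le\alpha\le\infty$, and let $f,g,h:\mathbb R^n\to\mathbb R_{\ge 0}$ be such that, if $\alpha\neq 0$, $$h\bigl((1-\lambda)^{1/p}(1-\mu)^{1/q}x+\lambda^{1/p}\mu^{1/q}y\bigr)\ \ge\ \mathcal S_\alpha^{t,s}\bigl(f(x),g(y)\bigr),\qquad t=(1-\lambda)^{1/p}(1-\mu)^{1/q},\quad s=\lambda^{1/p}\mu^{1/q},$$ for all $x\in K$, $y\in L$ with $f(x)g(y)>0$ and all $\mu\in[0,1]$, and, if $\alpha=0$, $$h\bigl((1-\lambda)x+\lambda y\bigr)\ge f(x)^{1-\lambda}g(y)^{\lambda}$$ for all $x\in K$, $y\in L$ with $f(x)g(y)>0$. Let $\Lambda\subset\mathbb R^n$ be the lattice of all integer combinations of linearly independent vectors $v_1,\dots,v_n\in\mathbb R^n$, and let $\varphi(x)=\sum_{i=1}^n x_iv_i$ for $x\in\mathbb R^n$. Then $$\sum_{z\in(M_p+\varphi((-1,1)^n))\cap\Lambda}h^{\diamond_{\mathcal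 B}}(z)\ \ge\ \mathcal M_{\frac{p\alpha}{n\alpha+1}}^\lambda\Bigl(\sum_{x\in K\cap\Lambda}f(x),\ \sum_{y\in L\cap\Lambda}g(y)\Bigr),$$ where $h^{\diamond_{\mathcal B}}(z)=\sup_{u\in\varphi((-1,1)^n)}h(z+u)\in[0,\infty]$ for $z\in\mathbb R^n$. -/

import Mathlib

open scoped Pointwise ENNReal

noncomputable section

/-- The `α`-sum of `a, b ≥ 0` with coefficients `t, s`, for `α ≠ 0` in `[-∞, ∞]`:
it is `0` if `ab = 0`, and otherwise `(t a^α + s b^α)^{1/α}` for real `α ≠ 0`,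
`max {a, b}` for `α = ∞` and `min {a, b}` for `α = -∞`.
(It is never used at `α = 0`.) -/
def alphaSum (t s : ℝ) (α : EReal) (a b : ℝ) : ℝ :=
  if a * b = 0 then 0
  else
    match α with
    | ⊤ => max a b
    | ⊥ => min a b
    | (r : ℝ) => (t * a ^ r + s * b ^ r) ^ (1 / r)

open Classical in
/-- The `α`-mean of `a, b ≥ 0` with weight `l`, for `α` in `[-∞, ∞]`: it is
`a^{1-l} b^l` for `α = 0`, and the `α`-sum with coefficients `1 - l, l` otherwise. -/
def alphaMean (l : ℝ) (α : EReal) (a b : ℝ) : ℝ :=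
  if α = 0 then a ^ (1 - l) * b ^ l else alphaSum (1 - l) l α a b

/-- The exponent `pα / (nα + 1)`, for `-1/n ≤ α ≤ ∞`, with its usual limit values:
`-∞` at `α = -1/n` and `p/n` at `α = ∞`. (It is never used at `α = -∞`.) -/
def lpExponent (n : ℕ) (p : ℝ) (α : EReal) : EReal :=
  match α with
  | ⊤ => ((p / n : ℝ) : EReal)
  | ⊥ => ⊥
  | (r : ℝ) => if n * r + 1 = 0 then ⊥ else ((p * r / (n * r + 1) : ℝ) : EReal)

/-- The coefficient `(1-l)^{1/p} (1-m)^{1/q}`, where `1/q = 1 - 1/p`. For `p = 1` the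
second factor is `1` (also at `m = 1`, since `0 ^ 0 = 1` for real powers). -/
def lpCoeffLeft (p l m : ℝ) : ℝ := (1 - l) ^ (1 / p) * (1 - m) ^ (1 - 1 / p)

/-- The coefficient `l^{1/p} m^{1/q}`, where `1/q = 1 - 1/p`. -/
def lpCoeffRight (p l m : ℝ) : ℝ := l ^ (1 / p) * m ^ (1 - 1 / p)

/-- The pointwise `p`-sum `K +_p L` of arbitrary sets, where `1/q = 1 - 1/p`. -/
def pSum {n : ℕ} (p : ℝ) (K L : Set (EuclideanSpace ℝ (Fin n))) :
    Set (EuclideanSpace ℝ (Fin n)) :=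
  {z | ∃ x ∈ K, ∃ y ∈ L, ∃ m ∈ Set.Icc (0 : ℝ) 1,
    z = (1 - m) ^ (1 - 1 / p) • x + m ^ (1 - 1 / p) • y}

/-- The `p`-scalar multiple `l · K = l^{1/p} K`. -/
def pSMul {n : ℕ} (p l : ℝ) (K : Set (EuclideanSpace ℝ (Fin n))) :
    Set (EuclideanSpace ℝ (Fin n)) :=
  l ^ (1 / p) • K

/-- The linear map `φ(x) = ∑ x_i v_i`. -/
def latticeMap {n : ℕ} (v : Fin n → EuclideanSpace ℝ (Fin n))
    (x : EuclideanSpace ℝ (Fin n)) : EuclideanSpace ℝ (Fin n) :=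
  ∑ i, x i • v i

/-- The lattice of all integer combinations of `v_1, …, v_n`. -/
def latticeSet {n : ℕ} (v : Fin n → EuclideanSpace ℝ (Fin n)) :
    Set (EuclideanSpace ℝ (Fin n)) :=
  (Submodule.span ℤ (Set.range v) : Set (EuclideanSpace ℝ (Fin n)))

/-- The open cube `(-1,1)^n`. -/
def openCube (n : ℕ) : Set (EuclideanSpace ℝ (Fin n)) :=
  {x | ∀ i, x i ∈ Set.Ioo (-1 : ℝ) 1}

/-- The sup-extension `z ↦ sup {h(z + u) : u ∈ φ((-1,1)^n)}` of a non-negative function.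
Since `h` need not be bounded, it takes values in `[0, ∞]`. -/
def supExtension {n : ℕ} (v : Fin n → EuclideanSpace ℝ (Fin n))
    (h : EuclideanSpace ℝ (Fin n) → ℝ) (z : EuclideanSpace ℝ (Fin n)) : ℝ≥0∞ :=
  ⨆ u ∈ latticeMap v '' openCube n, ENNReal.ofReal (h (z + u))

end

/-! For one fixed m the coefficients t, s satisfy t + s ≤ 1, and the claim is about ordinary
combinations t x + s y; the freedom in m matters only at the end. Coordinates with respect to v turn
the lattice into ℤⁿ, and boundedness of K and L makes f and g finitely supported.

On ℤ, at least t|A| + s|B| integers lie at distance less than 1 from tA + sB. Apply this to the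
superlevel sets of f and g at heights τF and τG, with F, G the maxima, and integrate over τ in (0,
1]: the sum of H is at least S(F, G) (t X/F + s Y/G), where X, Y are the sums of f and g. Hölder
(`HolderStep`) eliminates F and G and turns a power sum of exponent r into one of exponent r/(r +
1). Induction on the coordinates, with slice sums as the new functions, produces the exponents α/(kα
+ 1) and ends at β = α/(nα + 1).

It remains to replace β by pβ. For α > 0, `exists_powerSum_lpCoeff_eq` picks m, depending on X and
Y, for which the power sum of exponent β with the L_p coefficients equals the mean of exponent pβ.
For α ≤ 0 take m = l, where the coefficients are 1 - l and l: if -1/n < α < 0, then pβ ≤ β < 0 and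
means increase with the exponent; at α = -1/n the chain ends in the minimum, and at α = 0 the
geometric mean reproduces itself. -/

open Real

/-! ### Counting and layer cake on the integers -/

open MeasureTheory in
/-- A one-dimensional discrete Brunn–Minkowski inequality. -/
theorem card_add_card_le_tsum_indicator {t s : ℝ} (ht : 0 ≤ t) (hs : 0 ≤ s) (hts : t + s ≤ 1)
    (A B : Finset ℤ) (hA : A.Nonempty) (hB : B.Nonempty) (C : Set ℤ)
    (hC : ∀ a ∈ A, ∀ b ∈ B, ∀ z : ℤ, |(z : ℝ) - (t * a + s * b)| < 1 → z ∈ C) :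
    ENNReal.ofReal t * A.card + ENNReal.ofReal s * B.card
      ≤ ∑' z : ℤ, C.indicator (1 : ℤ → ℝ≥0∞) z := by
  set a₁ := A.max' hA
  set b₀ := B.min' hB
  have ha₁ : a₁ ∈ A := A.max'_mem hA
  have hb₀ : b₀ ∈ B := B.min'_mem hB
  -- Walk through the pairs (a, b₀) and then (a₁, b). Each a contributes an interval of length t and
  -- each b one of length s; the shift a₁ + 1 puts the second family to the right of the first.
  let I : ℤ → Set ℝ := fun a => Set.Ico (t * a + s * b₀) (t * a + s * b₀ + t)
  let J : ℤ → Set ℝ := fun b => Set.Ico (t * (a₁ + 1) + s * b) (t * (a₁ + 1) + s * b + s)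
  have hI : Pairwise (Function.onFun Disjoint I) := by
    refine (pairwise_disjoint_on I).2 fun a b hab => ?_
    refine Set.disjoint_left.2 fun x hx hy => ?_
    have h1 : (a : ℝ) + 1 ≤ b := by exact_mod_cast hab
    have h2 : x < t * a + s * b₀ + t := hx.2
    have h3 : t * b + s * b₀ ≤ x := hy.1
    nlinarith
  have hJ : Pairwise (Function.onFun Disjoint J) := by
    refine (pairwise_disjoint_on J).2 fun a b hab => ?_
    refine Set.disjoint_left.2 fun x hx hy => ?_
    have h1 : (a : ℝ) + 1 ≤ b := by exact_mod_cast hab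
    have h2 : x < t * (a₁ + 1) + s * a + s := hx.2
    have h3 : t * (a₁ + 1) + s * b ≤ x := hy.1
    nlinarith
  have hIJ : Disjoint (⋃ a ∈ A, I a) (⋃ b ∈ B, J b) := by
    simp only [Set.disjoint_iUnion_left, Set.disjoint_iUnion_right]
    intro b hb a ha
    refine Set.disjoint_left.2 fun x hx hy => ?_
    have h1 : (a : ℝ) ≤ a₁ := by exact_mod_cast A.le_max' a ha
    have h1' : (b₀ : ℝ) ≤ b := by exact_mod_cast B.min'_le b hb
    have h2 : x < t * a + s * b₀ + t := hx.2
    have h3 : t * (a₁ + 1) + s * b ≤ x := hy.1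
    nlinarith
  have hvol : volume ((⋃ a ∈ A, I a) ∪ ⋃ b ∈ B, J b)
      = ENNReal.ofReal t * A.card + ENNReal.ofReal s * B.card := by
    rw [measure_union hIJ (B.measurableSet_biUnion fun b _ => measurableSet_Ico),
      measure_biUnion_finset (fun a _ b _ hab => hI hab) (fun _ _ => measurableSet_Ico),
      measure_biUnion_finset (fun a _ b _ hab => hJ hab) (fun _ _ => measurableSet_Ico)]
    simp [I, J, mul_comm]
  -- The floor of a point of [ta + sb, ta + sb + 1) is at distance less than 1 from ta + sb, hence
  -- in C. The intervals of both families fit into such windows because t + s ≤ 1.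
  have hfloor : ∀ (a b : ℤ) (x : ℝ), a ∈ A → b ∈ B → t * a + s * b ≤ x →
      x < t * a + s * b + 1 → x ∈ ⋃ z : C, Set.Ico ((z : ℤ) : ℝ) ((z : ℤ) + 1) := by
    intro a b x ha hb h1 h2
    have h3 := Int.floor_le x
    have h4 := Int.lt_floor_add_one x
    refine Set.mem_iUnion.2 ⟨⟨⌊x⌋, hC a ha b hb _ ?_⟩, h3, h4⟩
    rw [abs_lt]; constructor <;> linarith
  have hsub : ((⋃ a ∈ A, I a) ∪ ⋃ b ∈ B, J b)
      ⊆ ⋃ z : C, Set.Ico ((z : ℤ) : ℝ) ((z : ℤ) + 1) := by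
    rintro x (hx | hx)
    · simp only [Set.mem_iUnion] at hx
      obtain ⟨a, ha, h1, h2⟩ := hx
      exact hfloor a b₀ x ha hb₀ h1 (by linarith)
    · simp only [Set.mem_iUnion] at hx
      obtain ⟨b, hb, h1, h2⟩ := hx
      exact hfloor a₁ b x ha₁ hb (by linarith) (by linarith)
  calc ENNReal.ofReal t * A.card + ENNReal.ofReal s * B.card
      = volume ((⋃ a ∈ A, I a) ∪ ⋃ b ∈ B, J b) := hvol.symm
    _ ≤ volume (⋃ z : C, Set.Ico ((z : ℤ) : ℝ) ((z : ℤ) + 1)) := measure_mono hsub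
    _ ≤ ∑' z : C, volume (Set.Ico ((z : ℤ) : ℝ) ((z : ℤ) + 1)) := measure_iUnion_le _
    _ = ∑' z : C, (1 : ℤ → ℝ≥0∞) z := by simp
    _ = ∑' z : ℤ, C.indicator (1 : ℤ → ℝ≥0∞) z := tsum_subtype C _

open MeasureTheory in
theorem lintegral_Ioc_indicator_le {c : ℝ} (h1 : c ≤ 1) :
    ∫⁻ τ in Set.Ioc (0 : ℝ) 1, {τ : ℝ | τ ≤ c}.indicator 1 τ = ENNReal.ofReal c := by
  have hm : MeasurableSet {τ : ℝ | τ ≤ c} := measurableSet_Iic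
  rw [lintegral_indicator_one hm, Measure.restrict_apply hm]
  have : {τ : ℝ | τ ≤ c} ∩ Set.Ioc 0 1 = Set.Ioc 0 c := by
    ext x; simp only [Set.mem_inter_iff, Set.mem_ofPred_eq, Set.mem_Ioc]
    constructor
    · rintro ⟨h, h2, _⟩; exact ⟨h2, h⟩
    · rintro ⟨h, h2⟩; exact ⟨h2, h, h2.trans h1⟩
  rw [this]; simp

-- Layer-cake formula. Heights are measured in units of F, so that two functions with different
-- maxima can share the parameter τ in (0, 1].
open MeasureTheory in
theorem lintegral_Ioc_card_le (f : ℤ → ℝ) {F : ℝ} (hF : 0 < F) (A : Finset ℤ)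
    (hf : ∀ a ∈ A, 0 ≤ f a) (hfF : ∀ a ∈ A, f a ≤ F) :
    ∫⁻ τ in Set.Ioc (0 : ℝ) 1, ((A.filter fun a => τ * F ≤ f a).card : ℝ≥0∞)
      = ENNReal.ofReal ((∑ a ∈ A, f a) / F) := by
  have : ∀ τ : ℝ, ((A.filter fun a => τ * F ≤ f a).card : ℝ≥0∞)
      = ∑ a ∈ A, {τ : ℝ | τ ≤ f a / F}.indicator 1 τ := by
    intro τ
    simp only [Set.indicator_apply, Set.mem_ofPred_eq, Pi.one_apply, Finset.sum_boole,
      le_div_iff₀ hF]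
  simp_rw [this]
  rw [lintegral_finsetSum A (fun a _ => measurable_one.indicator
      (measurableSet_Iic (a := f a / F)) : ∀ a ∈ A, Measurable ({τ : ℝ | τ ≤ f a / F}.indicator
      (1 : ℝ → ℝ≥0∞))), Finset.sum_div, ENNReal.ofReal_sum_of_nonneg fun a ha => div_nonneg (hf a ha) hF.le]
  exact Finset.sum_congr rfl fun a ha => lintegral_Ioc_indicator_le
    ((div_le_one hF).2 (hfF a ha))

/-! ### Borell–Brascamp–Lieb on ℤ and ℤⁿ -/

/-- `S` grows at least as fast as a monotone function that is homogeneous of degree one. -/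
def ScaleMono (S : ℝ → ℝ → ℝ) : Prop :=
  ∀ τ F G a b : ℝ, 0 < τ → 0 < F → 0 < G → τ * F ≤ a → τ * G ≤ b → τ * S F G ≤ S a b

/-- The Hölder type inequality that relates the means in consecutive dimensions. -/
def HolderStep (t s : ℝ) (S S' : ℝ → ℝ → ℝ) : Prop :=
  ∀ F G X Y : ℝ, 0 < F → 0 < G → 0 < X → 0 < Y →
    S' X Y ≤ S F G * (t * (X / F) + s * (Y / G))

theorem exists_max_of_finite_support {f : ℤ → ℝ} (hfs : f.support.Finite) (hpos : 0 < ∑' a, f a) :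
    ∃ a₀, 0 < f a₀ ∧ ∀ a, f a ≤ f a₀ := by
  have h1 : ∃ a, 0 < f a := by
    by_contra! h
    exact absurd hpos (not_lt.2 (tsum_nonpos h))
  obtain ⟨a, ha⟩ := h1
  have hne : hfs.toFinset.Nonempty := ⟨a, by simpa using ha.ne'⟩
  obtain ⟨a₀, _, h⟩ := Finset.exists_max_image _ f hne
  have h0 : 0 < f a₀ := ha.trans_le (h a (by simpa using ha.ne'))
  refine ⟨a₀, h0, fun b => ?_⟩
  by_cases hb : f b = 0
  · rw [hb]; exact h0.le
  · exact h b (by simpa using hb)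

open MeasureTheory in
/-- A discrete Borell–Brascamp–Lieb inequality on `ℤ`. -/
theorem discrete_bbl_int {t s : ℝ} (ht : 0 ≤ t) (hs : 0 ≤ s) (hts : t + s ≤ 1)
    {S S' : ℝ → ℝ → ℝ} (hS : ScaleMono S) (hSS' : HolderStep t s S S')
    (f g : ℤ → ℝ) (hf : ∀ a, 0 ≤ f a) (hg : ∀ a, 0 ≤ g a)
    (hfs : f.support.Finite) (hgs : g.support.Finite)
    (hfpos : 0 < ∑' a, f a) (hgpos : 0 < ∑' a, g a) (H : ℤ → ℝ≥0∞)
    (hH : ∀ a b : ℤ, 0 < f a → 0 < g b → ∀ z : ℤ, |(z : ℝ) - (t * a + s * b)| < 1 →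
      ENNReal.ofReal (S (f a) (g b)) ≤ H z) :
    ENNReal.ofReal (S' (∑' a, f a) (∑' b, g b)) ≤ ∑' z, H z := by
  obtain ⟨a₀, hF, hfF⟩ := exists_max_of_finite_support hfs hfpos
  obtain ⟨b₀, hG, hgG⟩ := exists_max_of_finite_support hgs hgpos
  set F := f a₀
  set G := g b₀
  set X := ∑' a, f a with hX
  set Y := ∑' a, g a with hY
  have hXs : X = ∑ a ∈ hfs.toFinset, f a := tsum_eq_sum (by simp)
  have hYs : Y = ∑ a ∈ hgs.toFinset, g a := tsum_eq_sum (by simp)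
  have hle := hSS' F G X Y hF hG hfpos hgpos
  have hsum0 : 0 ≤ t * (X / F) + s * (Y / G) := by positivity
  rcases le_or_gt (S F G) 0 with hS0 | hS0
  · rw [ENNReal.ofReal_of_nonpos (hle.trans (mul_nonpos_of_nonpos_of_nonneg hS0 hsum0))]
    exact zero_le
  refine (ENNReal.ofReal_le_ofReal hle).trans ?_
  -- For τ ≤ 1 the superlevel sets contain the maximisers a₀ and b₀, so both are nonempty, as the
  -- counting inequality requires.
  have key : ∀ τ ∈ Set.Ioc (0 : ℝ) 1,
      ENNReal.ofReal t * ((hfs.toFinset.filter fun a => τ * F ≤ f a).card : ℝ≥0∞)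
        + ENNReal.ofReal s * ((hgs.toFinset.filter fun a => τ * G ≤ g a).card : ℝ≥0∞)
      ≤ ∑' z : ℤ, {z : ℤ | ENNReal.ofReal (τ * S F G) ≤ H z}.indicator (1 : ℤ → ℝ≥0∞) z := by
    intro τ hτ
    apply card_add_card_le_tsum_indicator ht hs hts
    · exact ⟨a₀, by simpa [F, hF.ne'] using mul_le_of_le_one_left hF.le hτ.2⟩
    · exact ⟨b₀, by simpa [G, hG.ne'] using mul_le_of_le_one_left hG.le hτ.2⟩
    · intro a ha b hb z hz
      have ha := (Finset.mem_filter.1 ha).2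
      have hb := (Finset.mem_filter.1 hb).2
      exact (ENNReal.ofReal_le_ofReal (hS τ F G _ _ hτ.1 hF hG ha hb)).trans
        (hH a b ((mul_pos hτ.1 hF).trans_le ha) ((mul_pos hτ.1 hG).trans_le hb) z hz)
  have hmeas : ∀ z : ℤ, MeasurableSet {τ : ℝ | ENNReal.ofReal (τ * S F G) ≤ H z} := fun z =>
    measurableSet_le (by fun_prop) measurable_const
  -- Equality may fail here, since τ stops at 1 while H z can exceed S F G; only this direction is
  -- needed.
  have hlev : ∀ z : ℤ, ENNReal.ofReal (S F G) *
      ∫⁻ τ in Set.Ioc (0 : ℝ) 1,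
        {z : ℤ | ENNReal.ofReal (τ * S F G) ≤ H z}.indicator (1 : ℤ → ℝ≥0∞) z ≤ H z := by
    intro z
    by_cases hz : H z = ⊤
    · rw [hz]; exact le_top
    have : ∀ τ : ℝ, {z : ℤ | ENNReal.ofReal (τ * S F G) ≤ H z}.indicator (1 : ℤ → ℝ≥0∞) z
      = {τ : ℝ | ENNReal.ofReal (τ * S F G) ≤ H z}.indicator 1 τ := fun τ => by
      simp [Set.indicator_apply]
    simp_rw [this]
    rw [lintegral_indicator_one (hmeas z), Measure.restrict_apply (hmeas z)]
    have hsub : {τ : ℝ | ENNReal.ofReal (τ * S F G) ≤ H z} ∩ Set.Ioc 0 1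
        ⊆ Set.Ioc 0 ((H z).toReal / S F G) := by
      rintro τ ⟨h1, h2⟩
      exact ⟨h2.1, (le_div_iff₀ hS0).2 ((ENNReal.ofReal_le_iff_le_toReal hz).1 h1)⟩
    refine (mul_le_mul_right (measure_mono hsub) _).trans ?_
    rw [Real.volume_Ioc, sub_zero, ← ENNReal.ofReal_mul hS0.le, mul_div_cancel₀ _ hS0.ne',
      ENNReal.ofReal_toReal hz]
  have hint := setLIntegral_mono' (μ := volume) measurableSet_Ioc key
  have hm : ∀ (φ : ℤ → ℝ) (A : Finset ℤ) (c : ℝ), Measurable fun τ : ℝ =>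
      ((A.filter fun a => τ * c ≤ φ a).card : ℝ≥0∞) := by
    intro φ A c
    simp_rw [Finset.card_filter, Nat.cast_sum]
    refine Finset.measurable_sum _ fun a _ => ?_
    simp_rw [Nat.cast_ite]
    exact Measurable.ite (measurableSet_le (by fun_prop) measurable_const)
      measurable_const measurable_const
  rw [lintegral_add_left ((hm f _ F).const_mul _), lintegral_const_mul _ (hm f _ F),
    lintegral_const_mul _ (hm g _ G), lintegral_Ioc_card_le f hF _ (fun a _ => hf a)
      (fun a _ => hfF a), lintegral_Ioc_card_le g hG _ (fun a _ => hg a) (fun a _ => hgG a),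
    ← hXs, ← hYs, ← ENNReal.ofReal_mul ht, ← ENNReal.ofReal_mul hs,
    ← ENNReal.ofReal_add (by positivity) (by positivity)] at hint
  rw [lintegral_tsum] at hint
  · rw [ENNReal.ofReal_mul hS0.le]
    refine (mul_le_mul_right hint _).trans ?_
    rw [← ENNReal.tsum_mul_left]
    exact ENNReal.tsum_le_tsum hlev
  · intro z
    have : (fun τ : ℝ => {z : ℤ | ENNReal.ofReal (τ * S F G) ≤ H z}.indicator (1 : ℤ → ℝ≥0∞) z)
      = {τ : ℝ | ENNReal.ofReal (τ * S F G) ≤ H z}.indicator 1 := by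
      ext τ; simp [Set.indicator_apply]
    rw [this]
    exact (measurable_one.indicator (hmeas z)).aemeasurable

/-- A discrete Borell–Brascamp–Lieb inequality on `ℤⁿ`. -/
theorem discrete_bbl_pi {t s : ℝ} (ht : 0 ≤ t) (hs : 0 ≤ s) (hts : t + s ≤ 1)
    (n : ℕ) (S : ℕ → ℝ → ℝ → ℝ) (hS : ∀ k < n, ScaleMono (S k))
    (hSS : ∀ k < n, HolderStep t s (S k) (S (k + 1)))
    (f g : (Fin n → ℤ) → ℝ) (hf : ∀ a, 0 ≤ f a) (hg : ∀ a, 0 ≤ g a)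
    (hfs : f.support.Finite) (hgs : g.support.Finite)
    (hfpos : 0 < ∑' a, f a) (hgpos : 0 < ∑' a, g a) (H : (Fin n → ℤ) → ℝ≥0∞)
    (hH : ∀ a b, 0 < f a → 0 < g b → ∀ z : Fin n → ℤ,
      (∀ i, |(z i : ℝ) - (t * a i + s * b i)| < 1) →
      ENNReal.ofReal (S 0 (f a) (g b)) ≤ H z) :
    ENNReal.ofReal (S n (∑' a, f a) (∑' b, g b)) ≤ ∑' z, H z := by
  induction n with
  | zero =>
    rw [tsum_eq_single default fun b hb => absurd (Subsingleton.elim b _) hb] at hfpos hgpos ⊢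
    rw [tsum_eq_single default fun b hb => absurd (Subsingleton.elim b _) hb,
      tsum_eq_single default fun b hb => absurd (Subsingleton.elim b _) hb]
    exact hH _ _ hfpos hgpos _ fun i => i.elim0
  | succ n ih =>
    -- Split off the first coordinate. The induction hypothesis bounds the slice sums of H below by
    -- S n of the slice sums of f and g; the inequality on ℤ then passes from S n to S (n + 1).
    let e : ℤ × (Fin n → ℤ) ≃ (Fin (n + 1) → ℤ) := Fin.consEquiv fun _ => ℤ
    have hslice : ∀ φ : (Fin (n + 1) → ℤ) → ℝ, φ.support.Finite → ∀ k : ℤ,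
        (Function.support fun a => φ (e (k, a))).Finite := by
      intro φ hφ k
      exact hφ.preimage (f := fun a => e (k, a))
        ((e.injective.comp (Prod.mk_right_injective k)).injOn)
    have htsum : ∀ φ : (Fin (n + 1) → ℤ) → ℝ, φ.support.Finite →
        ∑' a, φ a = ∑' k : ℤ, ∑' a, φ (e (k, a)) := by
      intro φ hφ
      rw [← e.tsum_eq]
      exact (summable_of_hasFiniteSupport (hφ.preimage e.injective.injOn)).tsum_prod'
        fun k => summable_of_hasFiniteSupport (hslice φ hφ k)
    have hsupp : ∀ φ : (Fin (n + 1) → ℤ) → ℝ, φ.support.Finite →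
        (Function.support fun k : ℤ => ∑' a, φ (e (k, a))).Finite := by
      intro φ hφ
      refine (hφ.image fun a => a 0).subset fun k hk => ?_
      have : ∃ a, φ (e (k, a)) ≠ 0 := by
        by_contra! h
        exact hk (by simp [h])
      obtain ⟨a, ha⟩ := this
      exact ⟨e (k, a), ha, by simp [e]⟩
    rw [htsum f hfs] at hfpos ⊢
    rw [htsum g hgs] at hgpos ⊢
    rw [← e.tsum_eq H, ENNReal.tsum_prod (f := fun k a => H (e (k, a)))]
    refine discrete_bbl_int ht hs hts (hS n n.lt_succ_self) (hSS n n.lt_succ_self) _ _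
      (fun k => tsum_nonneg fun a => hf _) (fun k => tsum_nonneg fun a => hg _)
      (hsupp f hfs) (hsupp g hgs) hfpos hgpos _ ?_
    intro k j hk hj m hm
    refine ih (fun i hi => hS i (hi.trans n.lt_succ_self))
      (fun i hi => hSS i (hi.trans n.lt_succ_self)) _ _ (fun a => hf _) (fun a => hg _)
      (hslice f hfs k) (hslice g hgs j) hk hj _ ?_
    intro a b ha hb z hz
    refine hH _ _ ha hb _ fun i => ?_
    refine Fin.cases ?_ (fun i => ?_) i
    · simpa [e] using hm
    · simpa [e] using hz i

/-! ### Power sums and Hölder steps -/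

/-- Hölder's inequality for two terms, with weights `w` and `1 - w` as exponents. -/
theorem rpow_mul_rpow_add_le {w a₁ a₂ b₁ b₂ : ℝ} (hw0 : 0 ≤ w) (hw1 : w ≤ 1)
    (ha₁ : 0 < a₁) (ha₂ : 0 < a₂) (hb₁ : 0 < b₁) (hb₂ : 0 < b₂) :
    a₁ ^ w * b₁ ^ (1 - w) + a₂ ^ w * b₂ ^ (1 - w) ≤ (a₁ + a₂) ^ w * (b₁ + b₂) ^ (1 - w) := by
  have key : ∀ a b : ℝ, 0 < a → 0 < b → a ^ w * b ^ (1 - w) ≤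
      (w * (a / (a₁ + a₂)) + (1 - w) * (b / (b₁ + b₂)))
        * ((a₁ + a₂) ^ w * (b₁ + b₂) ^ (1 - w)) := by
    intro a b ha hb
    have h := geom_mean_le_arith_mean2_weighted hw0 (sub_nonneg.2 hw1)
      (div_pos ha (add_pos ha₁ ha₂)).le (div_pos hb (add_pos hb₁ hb₂)).le (by ring)
    rw [div_rpow ha.le (by positivity), div_rpow hb.le (by positivity), div_mul_div_comm,
      div_le_iff₀ (by positivity)] at h
    exact h
  refine (add_le_add (key _ _ ha₁ hb₁) (key _ _ ha₂ hb₂)).trans_eq ?_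
  rw [← add_mul]
  have : w * (a₁ / (a₁ + a₂)) + (1 - w) * (b₁ / (b₁ + b₂))
      + (w * (a₂ / (a₁ + a₂)) + (1 - w) * (b₂ / (b₁ + b₂))) = 1 := by
    field_simp; ring
  rw [this, one_mul]

/-- The power sum `(t a^r + s b^r)^{1/r}`. -/
noncomputable def powerSum (t s r a b : ℝ) : ℝ := (t * a ^ r + s * b ^ r) ^ (1 / r)

theorem powerSum_mul {t s r τ a b : ℝ} (ht : 0 < t) (hs : 0 < s) (hr : r ≠ 0) (hτ : 0 < τ)
    (ha : 0 < a) (hb : 0 < b) : powerSum t s r (τ * a) (τ * b) = τ * powerSum t s r a b := by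
  have : t * (τ * a) ^ r + s * (τ * b) ^ r = τ ^ r * (t * a ^ r + s * b ^ r) := by
    rw [mul_rpow hτ.le ha.le, mul_rpow hτ.le hb.le]; ring
  unfold powerSum
  rw [this, mul_rpow (by positivity) (by positivity), ← rpow_mul hτ.le, mul_one_div_cancel hr,
    rpow_one]

theorem powerSum_mono {t s r a b a' b' : ℝ} (ht : 0 < t) (hs : 0 < s) (hr : r ≠ 0)
    (ha : 0 < a) (hb : 0 < b) (haa : a ≤ a') (hbb : b ≤ b') :
    powerSum t s r a b ≤ powerSum t s r a' b' := by
  have ha' := ha.trans_le haa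
  have hb' := hb.trans_le hbb
  rcases hr.lt_or_gt with hr | hr
  · refine rpow_le_rpow_of_nonpos (by positivity) (add_le_add
      (mul_le_mul_of_nonneg_left (rpow_le_rpow_of_nonpos ha haa hr.le) ht.le)
      (mul_le_mul_of_nonneg_left (rpow_le_rpow_of_nonpos hb hbb hr.le) hs.le))
      (one_div_nonpos.2 hr.le)
  · exact rpow_le_rpow (by positivity) (by gcongr) (by positivity)

theorem scaleMono_powerSum {t s r : ℝ} (ht : 0 < t) (hs : 0 < s) (hr : r ≠ 0) :
    ScaleMono (powerSum t s r) := by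
  intro τ F G a b hτ hF hG ha hb
  rw [← powerSum_mul ht hs hr hτ hF hG]
  exact powerSum_mono ht hs hr (by positivity) (by positivity) ha hb

theorem scaleMono_max : ScaleMono max := by
  intro τ F G a b hτ _ _ ha hb
  rw [mul_max_of_nonneg _ _ hτ.le]
  exact max_le_max ha hb

theorem scaleMono_rpow_mul_rpow {l : ℝ} (h0 : 0 ≤ l) (h1 : l ≤ 1) :
    ScaleMono fun a b => a ^ (1 - l) * b ^ l := by
  intro τ F G a b hτ hF hG ha hb
  have : τ * (F ^ (1 - l) * G ^ l) = (τ * F) ^ (1 - l) * (τ * G) ^ l := by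
    rw [mul_rpow hτ.le hF.le, mul_rpow hτ.le hG.le]
    have : τ ^ (1 - l) * τ ^ l = τ := by rw [← rpow_add hτ]; simp
    linear_combination (-(F ^ (1 - l) * G ^ l)) * this
  have h2 : 0 ≤ 1 - l := by linarith
  rw [this]
  dsimp only
  have hF' : 0 < τ * F := by positivity
  have hG' : 0 < τ * G := by positivity
  exact mul_le_mul (rpow_le_rpow hF'.le ha h2) (rpow_le_rpow hG'.le hb h0) (by positivity)
    (rpow_nonneg (hF'.le.trans ha) _)

/-- With γ = r/(r + 1) one has 1/γ = 1 + 1/r. For r > 0 this is Hölder with weights γ, 1 - γ applied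
to t X^γ = (t X/F)^γ (t F^r)^(1-γ) and its analogue for s, Y, G. -/
theorem holderStep_powerSum {t s r : ℝ} (ht : 0 < t) (hs : 0 < s) (hr : r ≠ 0) (hr1 : 0 < r + 1) :
    HolderStep t s (powerSum t s r) (powerSum t s (r / (r + 1))) := by
  intro F G X Y hF hG hX hY
  unfold powerSum
  have hQ : 0 < t * F ^ r + s * G ^ r := by positivity
  have hP : 0 < t * (X / F) + s * (Y / G) := by positivity
  set γ := r / (r + 1) with hγ
  have hR : 0 < t * X ^ γ + s * Y ^ γ := by positivity
  have hγ0 : γ ≠ 0 := div_ne_zero hr hr1.ne'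
  have hfin : ((t * (X / F) + s * (Y / G)) ^ γ * (t * F ^ r + s * G ^ r) ^ (1 - γ)) ^ (1 / γ)
      = (t * F ^ r + s * G ^ r) ^ (1 / r) * (t * (X / F) + s * (Y / G)) := by
    rw [mul_rpow (by positivity) (by positivity), ← rpow_mul hP.le, ← rpow_mul hQ.le,
      mul_one_div_cancel hγ0, rpow_one, mul_comm]
    congr 2
    rw [hγ]; field_simp; ring
  rw [← hfin]
  rcases hr.lt_or_gt with hr | hr
  -- Now γ < 0, so the outer power 1/γ reverses the inequality. Hölder is used with weights -r, 1 +
  -- r on t F^r = (t X/F)^(-r) (t X^γ)^(1+r), and the result is raised to the power 1 - γ = 1/(1 +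
  -- r).
  · refine rpow_le_rpow_of_nonpos (by positivity) ?_
      (one_div_nonpos.2 (div_nonpos_of_nonpos_of_nonneg hr.le hr1.le))
    have term : ∀ c A B : ℝ, 0 < c → 0 < A → 0 < B →
        (c * (A / B)) ^ (-r) * (c * A ^ γ) ^ (1 - -r) = c * B ^ r := by
      intro c A B hc hA hB
      rw [mul_rpow hc.le (by positivity), mul_rpow hc.le (by positivity), div_rpow hA.le hB.le,
        ← rpow_mul hA.le, rpow_neg hB.le, div_inv_eq_mul]
      have h1 : γ * (1 - -r) = r := by rw [hγ]; field_simp; ring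
      have h2 : c ^ (-r) * c ^ (1 - -r) = c := by rw [← rpow_add hc]; simp
      have h3 : A ^ (-r) * A ^ r = 1 := by rw [← rpow_add hA]; simp
      rw [h1]
      linear_combination (A ^ (-r) * A ^ r * B ^ r) * h2 + c * B ^ r * h3
    have h := rpow_mul_rpow_add_le (w := -r) (by linarith) (by linarith)
      (show 0 < t * (X / F) by positivity) (show 0 < s * (Y / G) by positivity)
      (show 0 < t * X ^ γ by positivity) (show 0 < s * Y ^ γ by positivity)
    rw [term t X F ht hX hF, term s Y G hs hY hG] at h
    have hpos : 0 < 1 - γ := by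
      rw [hγ, sub_pos, div_lt_one hr1]; linarith
    have h' := rpow_le_rpow hQ.le h hpos.le
    rw [mul_rpow (by positivity) (by positivity), ← rpow_mul hP.le, ← rpow_mul hR.le] at h'
    have e1 : -r * (1 - γ) = -γ := by rw [hγ]; field_simp; ring
    have e2 : (1 - -r) * (1 - γ) = 1 := by rw [hγ]; field_simp; ring
    rw [e1, e2, rpow_one] at h'
    calc _ ≤ (t * (X / F) + s * (Y / G)) ^ γ *
          ((t * (X / F) + s * (Y / G)) ^ (-γ) * (t * X ^ γ + s * Y ^ γ)) := by gcongr
      _ = _ := by rw [← mul_assoc, ← rpow_add hP]; simp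
  · have hγpos : 0 < γ := by positivity
    refine rpow_le_rpow hR.le ?_ (by positivity)
    have term : ∀ c A B : ℝ, 0 < c → 0 < A → 0 < B →
        (c * (A / B)) ^ γ * (c * B ^ r) ^ (1 - γ) = c * A ^ γ := by
      intro c A B hc hA hB
      rw [mul_rpow hc.le (by positivity), mul_rpow hc.le (by positivity), div_rpow hA.le hB.le,
        ← rpow_mul hB.le]
      have h1 : r * (1 - γ) = γ := by rw [hγ]; field_simp; ring
      have h2 : c ^ γ * c ^ (1 - γ) = c := by rw [← rpow_add hc]; simp
      rw [h1]
      have hB' : B ^ γ ≠ 0 := by positivity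
      field_simp
      linear_combination h2
    have h := rpow_mul_rpow_add_le (w := γ) hγpos.le
      (by rw [hγ, div_le_one hr1]; linarith)
      (show 0 < t * (X / F) by positivity) (show 0 < s * (Y / G) by positivity)
      (show 0 < t * F ^ r by positivity) (show 0 < s * G ^ r by positivity)
    rwa [term t X F ht hX hF, term s Y G hs hY hG] at h

/-- The limit r = -1, where r/(r + 1) becomes -∞; it closes the chain for α = -1/n. -/
theorem holderStep_powerSum_neg_one_min {t s : ℝ} (ht : 0 < t) (hs : 0 < s) :
    HolderStep t s (powerSum t s (-1)) min := by
  intro F G X Y hF hG hX hY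
  unfold powerSum
  rw [show (1 : ℝ) / -1 = -1 by norm_num, rpow_neg_one, rpow_neg_one, rpow_neg_one, inv_mul_eq_div,
    le_div_iff₀ (by positivity), mul_add]
  have h1 : min X Y * (t * F⁻¹) ≤ t * (X / F) := by
    have : t * (X / F) = X * (t * F⁻¹) := by ring
    rw [this]; gcongr; exact min_le_left _ _
  have h2 : min X Y * (s * G⁻¹) ≤ s * (Y / G) := by
    have : s * (Y / G) = Y * (s * G⁻¹) := by ring
    rw [this]; gcongr; exact min_le_right _ _
  exact add_le_add h1 h2

/-- The limit r = ∞, where r/(r + 1) becomes 1; it opens the chain for α = ∞. -/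
theorem holderStep_max_powerSum_one {t s : ℝ} (ht : 0 ≤ t) (hs : 0 ≤ s) :
    HolderStep t s max (powerSum t s 1) := by
  intro F G X Y hF hG hX hY
  simp only [powerSum, rpow_one, div_one, mul_add]
  have h1 : t * X ≤ max F G * (t * (X / F)) := by
    calc t * X = F * (t * (X / F)) := by field_simp
      _ ≤ _ := by gcongr; exact le_max_left _ _
  have h2 : s * Y ≤ max F G * (s * (Y / G)) := by
    calc s * Y = G * (s * (Y / G)) := by field_simp
      _ ≤ _ := by gcongr; exact le_max_right _ _
  exact add_le_add h1 h2

/-- Weighted AM–GM for X/F and Y/G. The weights must add up to 1, which is why α = 0 is treated with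
m = l. -/
theorem holderStep_rpow_mul_rpow {l : ℝ} (h0 : 0 ≤ l) (h1 : l ≤ 1) :
    HolderStep (1 - l) l (fun a b => a ^ (1 - l) * b ^ l) (fun a b => a ^ (1 - l) * b ^ l) := by
  intro F G X Y hF hG hX hY
  have h := geom_mean_le_arith_mean2_weighted (sub_nonneg.2 h1) h0
    (div_pos hX hF).le (div_pos hY hG).le (by ring)
  rw [div_rpow hX.le hF.le, div_rpow hY.le hG.le, div_mul_div_comm,
    div_le_iff₀ (by positivity)] at h
  exact h.trans_eq (mul_comm _ _)

/-- Power means with negative exponents increase with the exponent. -/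
theorem powerSum_mul_le_powerSum {t s p r a b : ℝ} (ht : 0 < t) (hs : 0 < s) (hts : t + s = 1)
    (hp : 1 ≤ p) (hr : r < 0) (ha : 0 < a) (hb : 0 < b) :
    powerSum t s (p * r) a b ≤ powerSum t s r a b := by
  have h := (convexOn_rpow hp).2 (rpow_pos_of_pos ha r).le (rpow_pos_of_pos hb r).le
    ht.le hs.le hts
  simp only [smul_eq_mul] at h
  rw [← rpow_mul ha.le, ← rpow_mul hb.le, mul_comm r p] at h
  have hp0 : 0 < p := by linarith
  have h' := rpow_le_rpow_of_nonpos (by positivity) h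
    (one_div_nonpos.2 (mul_nonpos_of_nonneg_of_nonpos hp0.le hr.le))
  rw [← rpow_mul (by positivity)] at h'
  unfold powerSum
  refine h'.trans_eq ?_
  congr 1
  field_simp

/-! ### Passage from the lattice to ℤⁿ -/

theorem latticeMap_add {n : ℕ} (v : Fin n → EuclideanSpace ℝ (Fin n))
    (x y : EuclideanSpace ℝ (Fin n)) :
    latticeMap v (x + y) = latticeMap v x + latticeMap v y := by
  simp [latticeMap, add_smul, Finset.sum_add_distrib]

theorem latticeMap_smul {n : ℕ} (v : Fin n → EuclideanSpace ℝ (Fin n)) (c : ℝ)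
    (x : EuclideanSpace ℝ (Fin n)) : latticeMap v (c • x) = c • latticeMap v x := by
  simp [latticeMap, mul_smul, Finset.smul_sum]

theorem finite_inter_latticeSet {n : ℕ} {v : Fin n → EuclideanSpace ℝ (Fin n)}
    (hv : LinearIndependent ℝ v) {K : Set (EuclideanSpace ℝ (Fin n))}
    (hK : Bornology.IsBounded K) : (K ∩ latticeSet v).Finite := by
  cases n with
  | zero => exact Set.toFinite _
  | succ n =>
    have h := ZSpan.setFinite_inter (basisOfLinearIndependentOfCardEqFinrank hv (by simp)) hK
    rwa [coe_basisOfLinearIndependentOfCardEqFinrank] at h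

/-- The embedding of `ℤⁿ` onto the lattice spanned by `v`. -/
noncomputable def latticePoint {n : ℕ} (v : Fin n → EuclideanSpace ℝ (Fin n)) (a : Fin n → ℤ) :
    EuclideanSpace ℝ (Fin n) :=
  latticeMap v (WithLp.toLp 2 fun i => (a i : ℝ))

theorem range_latticePoint {n : ℕ} (v : Fin n → EuclideanSpace ℝ (Fin n)) :
    Set.range (latticePoint v) = latticeSet v := by
  ext x
  simp [latticeSet, Submodule.mem_span_range_iff_exists_fun, latticePoint, latticeMap,
    Int.cast_smul_eq_zsmul]

theorem latticePoint_injective {n : ℕ} {v : Fin n → EuclideanSpace ℝ (Fin n)}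
    (hv : LinearIndependent ℝ v) : Function.Injective (latticePoint v) := by
  intro a b hab
  simp only [latticePoint, latticeMap] at hab
  have h := Fintype.linearIndependent_iff.1 hv (fun i => (a i : ℝ) - b i) (by
    simpa [sub_smul, Finset.sum_sub_distrib, sub_eq_zero] using hab)
  ext i
  exact_mod_cast sub_eq_zero.1 (h i)

theorem finite_support_indicator_latticePoint {n : ℕ} {v : Fin n → EuclideanSpace ℝ (Fin n)}
    (hv : LinearIndependent ℝ v) {K : Set (EuclideanSpace ℝ (Fin n))}
    (hK : Bornology.IsBounded K) (f : EuclideanSpace ℝ (Fin n) → ℝ) :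
    (Function.support fun a => K.indicator f (latticePoint v a)).Finite := by
  refine ((finite_inter_latticeSet hv hK).preimage (latticePoint_injective hv).injOn).subset ?_
  intro a ha
  exact ⟨Set.mem_of_indicator_ne_zero ha, range_latticePoint v ▸ Set.mem_range_self a⟩

theorem finsum_mem_inter_latticeSet {n : ℕ} {v : Fin n → EuclideanSpace ℝ (Fin n)}
    (hv : LinearIndependent ℝ v) {K : Set (EuclideanSpace ℝ (Fin n))}
    (hK : Bornology.IsBounded K) (f : EuclideanSpace ℝ (Fin n) → ℝ) :
    ∑ᶠ x ∈ K ∩ latticeSet v, f x = ∑' a, K.indicator f (latticePoint v a) := by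
  rw [tsum_eq_finsum (finite_support_indicator_latticePoint hv hK f),
    ← finsum_mem_range (f := K.indicator f) (latticePoint_injective hv), range_latticePoint,
    finsum_mem_def, finsum_mem_def, Set.indicator_indicator, Set.inter_comm]

theorem tsum_inter_latticeSet {n : ℕ} {v : Fin n → EuclideanSpace ℝ (Fin n)}
    (hv : LinearIndependent ℝ v) (N : Set (EuclideanSpace ℝ (Fin n)))
    (H : EuclideanSpace ℝ (Fin n) → ℝ≥0∞) :
    ∑' z : ↥(N ∩ latticeSet v), H z = ∑' a, N.indicator H (latticePoint v a) := by
  rw [tsum_subtype (N ∩ latticeSet v) H, Set.inter_comm, ← Set.indicator_indicator,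
    ← range_latticePoint, ← (latticePoint_injective hv).tsum_eq]
  · simp
  · exact Set.support_indicator_subset

/-- A discrete Borell–Brascamp–Lieb inequality for lattices with coefficients `t, s > 0`. -/
theorem discrete_bbl_lattice {n : ℕ} {t s : ℝ} (ht : 0 ≤ t) (hs : 0 ≤ s) (hts : t + s ≤ 1)
    (S : ℕ → ℝ → ℝ → ℝ) (hS : ∀ k < n, ScaleMono (S k))
    (hSS : ∀ k < n, HolderStep t s (S k) (S (k + 1)))
    {v : Fin n → EuclideanSpace ℝ (Fin n)} (hv : LinearIndependent ℝ v)
    {K L M : Set (EuclideanSpace ℝ (Fin n))}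
    (hK : Bornology.IsBounded K) (hL : Bornology.IsBounded L)
    (hM : ∀ x ∈ K, ∀ y ∈ L, t • x + s • y ∈ M)
    {f g h : EuclideanSpace ℝ (Fin n) → ℝ} (hf : ∀ x, 0 ≤ f x) (hg : ∀ x, 0 ≤ g x)
    (hfgh : ∀ x ∈ K, ∀ y ∈ L, 0 < f x → 0 < g y → S 0 (f x) (g y) ≤ h (t • x + s • y))
    (hfpos : 0 < ∑ᶠ x ∈ K ∩ latticeSet v, f x) (hgpos : 0 < ∑ᶠ y ∈ L ∩ latticeSet v, g y) :
    ENNReal.ofReal (S n (∑ᶠ x ∈ K ∩ latticeSet v, f x) (∑ᶠ y ∈ L ∩ latticeSet v, g y))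
      ≤ ∑' z : ↥((M + latticeMap v '' openCube n) ∩ latticeSet v), supExtension v h z := by
  rw [finsum_mem_inter_latticeSet hv hK] at hfpos ⊢
  rw [finsum_mem_inter_latticeSet hv hL] at hgpos ⊢
  rw [tsum_inter_latticeSet hv]
  refine discrete_bbl_pi ht hs hts n S hS hSS _ _
    (fun a => Set.indicator_nonneg (fun x _ => hf x) _)
    (fun a => Set.indicator_nonneg (fun x _ => hg x) _)
    (finite_support_indicator_latticePoint hv hK f)
    (finite_support_indicator_latticePoint hv hL g) hfpos hgpos _ ?_
  intro a b ha hb z hz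
  have haK := Set.mem_of_indicator_ne_zero ha.ne'
  have hbL := Set.mem_of_indicator_ne_zero hb.ne'
  rw [Set.indicator_of_mem haK] at ha ⊢
  rw [Set.indicator_of_mem hbL] at hb ⊢
  -- The coordinate offset of z from ta + sb. It puts the lattice point of z in M plus the image of
  -- the cube, while -u, also in the cube, leads back from z to the point where h is bounded below.
  let u : EuclideanSpace ℝ (Fin n) := WithLp.toLp 2 fun i => (z i : ℝ) - (t * a i + s * b i)
  have hu : u ∈ openCube n := fun i => abs_lt.1 (hz i)
  have hu' : (-1 : ℝ) • u ∈ openCube n := fun i => by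
    have := abs_lt.1 (hz i)
    simp only [u, PiLp.smul_apply, smul_eq_mul, Set.mem_Ioo]
    constructor <;> linarith
  have hz' : latticePoint v z = t • latticePoint v a + s • latticePoint v b + latticeMap v u := by
    simp only [latticePoint, ← latticeMap_smul, ← latticeMap_add]
    congr 1
    ext i
    simp [u]
  rw [Set.indicator_of_mem]
  · refine le_trans ?_ (le_iSup₂ (f := fun w _ => ENNReal.ofReal (h (latticePoint v z + w)))
      (latticeMap v ((-1 : ℝ) • u)) (Set.mem_image_of_mem _ hu'))
    refine ENNReal.ofReal_le_ofReal ((hfgh _ haK _ hbL ha hb).trans_eq ?_)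
    rw [hz', latticeMap_smul]
    congr 1
    simp
  · exact hz' ▸ Set.add_mem_add (hM _ haK _ hbL) (Set.mem_image_of_mem _ hu)

/-! ### The L_p coefficients and the choice of m -/

theorem lpCoeffLeft_pos {p l m : ℝ} (hl : l < 1) (hm : m < 1) : 0 < lpCoeffLeft p l m :=
  mul_pos (rpow_pos_of_pos (by linarith) _) (rpow_pos_of_pos (by linarith) _)

theorem lpCoeffRight_pos {p l m : ℝ} (hl : 0 < l) (hm : 0 < m) : 0 < lpCoeffRight p l m :=
  mul_pos (rpow_pos_of_pos hl _) (rpow_pos_of_pos hm _)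

/-- Weighted AM–GM with weights 1/p and 1 - 1/p for each coefficient; the two arithmetic means add
up to 1. -/
theorem lpCoeff_add_le_one {p l m : ℝ} (hp : 1 ≤ p) (hl : l ∈ Set.Icc (0 : ℝ) 1)
    (hm : m ∈ Set.Icc (0 : ℝ) 1) : lpCoeffLeft p l m + lpCoeffRight p l m ≤ 1 := by
  have hp0 : 0 ≤ 1 / p := by positivity
  have hp1 : 0 ≤ 1 - 1 / p := by
    rw [sub_nonneg, div_le_one (by linarith)]; exact hp
  have h1 := geom_mean_le_arith_mean2_weighted hp0 hp1 (sub_nonneg.2 hl.2) (sub_nonneg.2 hm.2)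
    (by ring)
  have h2 := geom_mean_le_arith_mean2_weighted hp0 hp1 hl.1 hm.1 (by ring)
  refine (add_le_add h1 h2).trans_eq ?_
  ring

theorem lpCoeffLeft_self {p l : ℝ} (hl : l < 1) : lpCoeffLeft p l l = 1 - l := by
  rw [lpCoeffLeft, ← rpow_add (by linarith)]; simp

theorem lpCoeffRight_self {p l : ℝ} (hl : 0 < l) : lpCoeffRight p l l = l := by
  rw [lpCoeffRight, ← rpow_add hl]; simp

theorem lpCoeff_smul_add_mem_pSum {n : ℕ} {p l m : ℝ} (hm : m ∈ Set.Icc (0 : ℝ) 1)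
    {K L : Set (EuclideanSpace ℝ (Fin n))} {x y : EuclideanSpace ℝ (Fin n)}
    (hx : x ∈ K) (hy : y ∈ L) :
    lpCoeffLeft p l m • x + lpCoeffRight p l m • y
      ∈ pSum p (pSMul p (1 - l) K) (pSMul p l L) := by
  refine ⟨_, Set.smul_mem_smul_set hx, _, Set.smul_mem_smul_set hy, m, hm, ?_⟩
  simp only [lpCoeffLeft, lpCoeffRight, smul_smul, mul_comm]

/-- The parameter `m` that turns Hölder's inequality into an equality. -/
theorem exists_powerSum_lpCoeff_eq {p l b X Y : ℝ} (hp : 1 ≤ p) (hl : l ∈ Set.Ioo (0 : ℝ) 1)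
    (hX : 0 < X) (hY : 0 < Y) :
    ∃ m ∈ Set.Ioo (0 : ℝ) 1,
      powerSum (lpCoeffLeft p l m) (lpCoeffRight p l m) b X Y = powerSum (1 - l) l (p * b) X Y := by
  have hl1 : 0 < 1 - l := by linarith [hl.2]
  have hl0 : 0 < l := hl.1
  have hp0 : 0 < p := by linarith
  set A := (1 - l) * X ^ (p * b) with hA
  set B := l * Y ^ (p * b) with hB
  have hA0 : 0 < A := by positivity
  have hB0 : 0 < B := by positivity
  have hN : 0 < A + B := by positivity
  have term : ∀ c Z D : ℝ, 0 < c → 0 < Z → D = c * Z ^ (p * b) →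
      c ^ (1 / p) * (D / (A + B)) ^ (1 - 1 / p) * Z ^ b = D * (A + B) ^ (1 / p - 1) := by
    intro c Z D hc hZ hD
    have hD0 : 0 < D := by rw [hD]; positivity
    have h1 : D ^ (1 / p) = c ^ (1 / p) * Z ^ b := by
      rw [hD, mul_rpow hc.le (by positivity), ← rpow_mul hZ.le]
      congr 2; field_simp
    have h2 : D ^ (1 / p) * D ^ (1 - 1 / p) = D := by rw [← rpow_add hD0]; simp
    have h3 : (A + B) ^ (1 / p - 1) = ((A + B) ^ (1 - 1 / p))⁻¹ := by
      rw [← rpow_neg hN.le]; congr 1; ring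
    rw [div_rpow hD0.le hN.le, h3, div_eq_mul_inv (D ^ _)]
    generalize 1 / p = w at h1 h2 ⊢
    linear_combination (D ^ (1 - w) * ((A + B) ^ (1 - w))⁻¹) * (-h1)
      + ((A + B) ^ (1 - w))⁻¹ * h2
  -- The equality case of Hölder: 1 - m and m are proportional to A and B. The two terms of the
  -- power sum are then A and B times (A + B)^(1/p - 1), with total (A + B)^(1/p).
  refine ⟨B / (A + B), ⟨by positivity, (div_lt_one hN).2 (by linarith)⟩, ?_⟩
  have h1m : 1 - B / (A + B) = A / (A + B) := by field_simp; ring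
  unfold powerSum lpCoeffLeft lpCoeffRight
  rw [h1m, term (1 - l) X A hl1 hX rfl, term l Y B hl0 hY rfl, ← add_mul, ← hA, ← hB]
  have : (A + B) * (A + B) ^ (1 / p - 1) = (A + B) ^ (1 / p) := by
    nth_rewrite 1 [← rpow_one (A + B)]
    rw [← rpow_add hN]; congr 1; ring
  rw [this, ← rpow_mul hN.le]
  congr 1
  rw [div_mul_div_comm, one_mul]

/-! ### Evaluation of the means and the final case distinction -/

theorem alphaSum_of_mul_eq_zero {t s a b : ℝ} (α : EReal) (h : a * b = 0) :
    alphaSum t s α a b = 0 := if_pos h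

theorem alphaSum_coe {t s a b : ℝ} (r : ℝ) (h : a * b ≠ 0) :
    alphaSum t s (r : EReal) a b = powerSum t s r a b := if_neg h

theorem alphaSum_top {t s a b : ℝ} (h : a * b ≠ 0) : alphaSum t s ⊤ a b = max a b := if_neg h

theorem alphaSum_bot {t s a b : ℝ} (h : a * b ≠ 0) : alphaSum t s ⊥ a b = min a b := if_neg h

theorem alphaMean_coe {l r a b : ℝ} (hr : r ≠ 0) (h : a * b ≠ 0) :
    alphaMean l (r : EReal) a b = powerSum (1 - l) l r a b := by
  rw [alphaMean, if_neg (by exact_mod_cast hr), alphaSum_coe r h]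

theorem alphaMean_of_mul_eq_zero {l a b : ℝ} (hl : l ∈ Set.Ioo (0 : ℝ) 1) (α : EReal)
    (h : a * b = 0) : alphaMean l α a b = 0 := by
  unfold alphaMean
  split_ifs
  · rcases mul_eq_zero.1 h with h | h
    · rw [h, zero_rpow (by linarith [hl.2]), zero_mul]
    · rw [h, zero_rpow hl.1.ne', mul_zero]
  · exact alphaSum_of_mul_eq_zero α h

theorem lpExponent_coe {n : ℕ} {p : ℝ} (r : ℝ) : lpExponent n p (r : EReal)
    = if n * r + 1 = 0 then ⊥ else ((p * r / (n * r + 1) : ℝ) : EReal) := rfl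

/-- The Hölder chain of power sums that starts at the exponent `r`. -/
theorem holderStep_powerSum_div {t s r : ℝ} (ht : 0 < t) (hs : 0 < s) (hr : r ≠ 0) (k : ℕ)
    (h0 : 0 < k * r + 1) (h1 : 0 < (k + 1 : ℕ) * r + 1) :
    HolderStep t s (powerSum t s (r / (k * r + 1)))
      (powerSum t s (r / ((k + 1 : ℕ) * r + 1))) := by
  have e1 : r / (k * r + 1) + 1 = ((k + 1 : ℕ) * r + 1) / (k * r + 1) := by
    rw [eq_div_iff h0.ne', add_mul, div_mul_cancel₀ _ h0.ne']; push_cast; ring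
  have h := holderStep_powerSum ht hs (div_ne_zero hr h0.ne') (by rw [e1]; positivity)
  rwa [e1, div_div_div_cancel_right₀ h0.ne'] at h

theorem corollaryc (n : ℕ) (hn : 1 ≤ n) (l p : ℝ) (hl : l ∈ Set.Ioo (0 : ℝ) 1) (hp : 1 ≤ p)
    (K L : Set (EuclideanSpace ℝ (Fin n)))
    (hKne : K.Nonempty) (hLne : L.Nonempty)
    (hK : Bornology.IsBounded K) (hL : Bornology.IsBounded L)
    (α : EReal) (hα : ((-(1 / (n : ℝ)) : ℝ) : EReal) ≤ α)
    (f g h : EuclideanSpace ℝ (Fin n) → ℝ)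
    (hf : ∀ x, 0 ≤ f x) (hg : ∀ x, 0 ≤ g x) (hh : ∀ x, 0 ≤ h x)
    (hfgh : α ≠ 0 → ∀ x ∈ K, ∀ y ∈ L, 0 < f x * g y → ∀ m ∈ Set.Icc (0 : ℝ) 1,
      alphaSum (lpCoeffLeft p l m) (lpCoeffRight p l m) α (f x) (g y)
        ≤ h (lpCoeffLeft p l m • x + lpCoeffRight p l m • y))
    (hfgh_zero : α = 0 → ∀ x ∈ K, ∀ y ∈ L, 0 < f x * g y →
      f x ^ (1 - l) * g y ^ l ≤ h ((1 - l) • x + l • y))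
    (v : Fin n → EuclideanSpace ℝ (Fin n)) (hv : LinearIndependent ℝ v) :
    ENNReal.ofReal
        (alphaMean l (lpExponent n p α)
          (∑ᶠ x ∈ K ∩ latticeSet v, f x) (∑ᶠ y ∈ L ∩ latticeSet v, g y))
      ≤ ∑' z : ↥((pSum p (pSMul p (1 - l) K) (pSMul p l L) + latticeMap v '' openCube n)
            ∩ latticeSet v),
          supExtension v h z := by
  have hl0 : 0 < l := hl.1
  have hl1 : 0 < 1 - l := sub_pos.2 hl.2
  have hn0 : (0 : ℝ) < n := by exact_mod_cast hn
  set X := ∑ᶠ x ∈ K ∩ latticeSet v, f x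
  set Y := ∑ᶠ y ∈ L ∩ latticeSet v, g y
  have hX0 : 0 ≤ X := finsum_nonneg fun x => finsum_nonneg fun _ => hf x
  have hY0 : 0 ≤ Y := finsum_nonneg fun x => finsum_nonneg fun _ => hg x
  by_cases hXY : X * Y = 0
  · rw [alphaMean_of_mul_eq_zero hl _ hXY, ENNReal.ofReal_zero]
    exact zero_le
  have hX : 0 < X := hX0.lt_of_ne' (left_ne_zero_of_mul hXY)
  have hY : 0 < Y := hY0.lt_of_ne' (right_ne_zero_of_mul hXY)
  have main : ∀ m ∈ Set.Ioo (0 : ℝ) 1, ∀ S : ℕ → ℝ → ℝ → ℝ, (∀ k < n, ScaleMono (S k)) →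
      (∀ k < n, HolderStep (lpCoeffLeft p l m) (lpCoeffRight p l m) (S k) (S (k + 1))) →
      (∀ x ∈ K, ∀ y ∈ L, 0 < f x → 0 < g y → S 0 (f x) (g y)
        ≤ h (lpCoeffLeft p l m • x + lpCoeffRight p l m • y)) →
      ENNReal.ofReal (S n X Y)
        ≤ ∑' z : ↥((pSum p (pSMul p (1 - l) K) (pSMul p l L) + latticeMap v '' openCube n)
            ∩ latticeSet v), supExtension v h z := fun m hm S hS hSS hS0 =>
    discrete_bbl_lattice (lpCoeffLeft_pos hl.2 hm.2).le (lpCoeffRight_pos hl0 hm.1).le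
      (lpCoeff_add_le_one hp ⟨hl0.le, hl.2.le⟩ ⟨hm.1.le, hm.2.le⟩) S hS hSS hv hK hL
      (fun x hx y hy => lpCoeff_smul_add_mem_pSum ⟨hm.1.le, hm.2.le⟩ hx hy) hf hg hS0 hX hY
  have hself : ∀ S : ℕ → ℝ → ℝ → ℝ, (∀ k < n, ScaleMono (S k)) →
      (∀ k < n, HolderStep (1 - l) l (S k) (S (k + 1))) →
      (∀ x ∈ K, ∀ y ∈ L, 0 < f x → 0 < g y → S 0 (f x) (g y) ≤ h ((1 - l) • x + l • y)) →
      ENNReal.ofReal (S n X Y)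
        ≤ ∑' z : ↥((pSum p (pSMul p (1 - l) K) (pSMul p l L) + latticeMap v '' openCube n)
            ∩ latticeSet v), supExtension v h z := by
    have := main l hl
    rwa [lpCoeffLeft_self hl.2, lpCoeffRight_self hl0] at this
  induction α with
  | bot => exact absurd hα (by simp)
  | top =>
    have hpn : (p / n : ℝ) ≠ 0 := by positivity
    change ENNReal.ofReal (alphaMean l ((p / n : ℝ) : EReal) X Y) ≤ _
    rw [alphaMean_coe hpn hXY]
    obtain ⟨m, hm, hmeq⟩ := exists_powerSum_lpCoeff_eq (b := 1 / n) hp hl hX hY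
    rw [mul_one_div] at hmeq
    rw [← hmeq]
    have ht : 0 < lpCoeffLeft p l m := lpCoeffLeft_pos hl.2 hm.2
    have hs : 0 < lpCoeffRight p l m := lpCoeffRight_pos hl0 hm.1
    -- For α = ∞ the exponents are ∞, 1, 1/2, …, 1/n; hence m was chosen with b = 1/n.
    have := main m hm (fun k => if k = 0 then max else
      powerSum (lpCoeffLeft p l m) (lpCoeffRight p l m) (1 / k)) ?_ ?_ ?_
    · simpa only [if_neg (show n ≠ 0 by omega)] using this
    · intro k _
      split_ifs with hk
      · exact scaleMono_max
      · exact scaleMono_powerSum ht hs (by positivity)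
    · intro k _
      rcases Nat.eq_zero_or_pos k with rfl | hk
      · simpa using holderStep_max_powerSum_one ht.le hs.le
      · have hk' : (0 : ℝ) < k := by exact_mod_cast hk
        have := holderStep_powerSum ht hs (r := 1 / k) (by positivity) (by positivity)
        rw [show (1 / (k : ℝ)) / (1 / k + 1) = 1 / (k + 1 : ℕ) by
          push_cast; field_simp; ring] at this
        simpa only [if_neg hk.ne', if_neg (Nat.succ_ne_zero k)] using this
    · intro x hx y hy hfx hgy
      have := hfgh (by simp) x hx y hy (mul_pos hfx hgy) m ⟨hm.1.le, hm.2.le⟩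
      rwa [alphaSum_top (mul_pos hfx hgy).ne'] at this
  | coe r =>
    have hα : -(1 / (n : ℝ)) ≤ r := by exact_mod_cast hα
    have hnr : 0 ≤ n * r + 1 := by
      have := mul_le_mul_of_nonneg_left hα hn0.le
      rw [mul_neg, mul_one_div_cancel hn0.ne'] at this
      linarith
    -- Strict even at r = -1/n: the denominator can vanish only at k = n, so only the last step can
    -- degenerate.
    have hkr : ∀ k < n, 0 < k * r + 1 := by
      intro k hk
      have hk' : (k : ℝ) < n := by exact_mod_cast hk
      rcases le_or_gt 0 r with hr | hr
      · positivity
      · nlinarith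
    rcases lt_trichotomy r 0 with hr | rfl | hr
    · have hr' : (r : EReal) ≠ 0 := by exact_mod_cast hr.ne
      have hS0 : ∀ x ∈ K, ∀ y ∈ L, 0 < f x → 0 < g y →
          powerSum (1 - l) l r (f x) (g y) ≤ h ((1 - l) • x + l • y) := by
        intro x hx y hy hfx hgy
        have := hfgh hr' x hx y hy (mul_pos hfx hgy) l ⟨hl0.le, hl.2.le⟩
        rwa [lpCoeffLeft_self hl.2, lpCoeffRight_self hl0,
          alphaSum_coe r (mul_pos hfx hgy).ne'] at this
      rw [lpExponent_coe]
      split_ifs with h0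
      · rw [alphaMean, if_neg (by simp), alphaSum_bot hXY]
        have := hself (fun k => if k = n then min else powerSum (1 - l) l (r / (k * r + 1)))
          ?_ ?_ ?_
        · simpa only [if_true] using this
        · intro k hk
          simpa only [if_neg hk.ne] using
            scaleMono_powerSum hl1 hl0 (div_ne_zero hr.ne (hkr k hk).ne')
        · intro k hk
          simp only [if_neg hk.ne]
          split_ifs with hkn
          -- With r = -1/n and k = n - 1 the exponent has reached -1, and the last step leads to the
          -- minimum.
          · have hk1 : r / (k * r + 1) = -1 := by
              rw [div_eq_iff (hkr k hk).ne']
              rw [← hkn] at h0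
              push_cast at h0
              linarith
            rw [hk1]
            exact holderStep_powerSum_neg_one_min hl1 hl0
          · exact holderStep_powerSum_div hl1 hl0 hr.ne k (hkr k hk) (hkr _ (by omega))
        · simpa [show (0 : ℕ) ≠ n by omega] using hS0
      · have hpos : 0 < n * r + 1 := hnr.lt_of_ne' h0
        rw [alphaMean_coe (div_ne_zero (mul_ne_zero (by linarith) hr.ne) h0) hXY, mul_div_assoc]
        -- The chain with m = l gives the mean of exponent β = r/(nr + 1) < 0, which dominates the
        -- required mean of exponent pβ.
        refine (ENNReal.ofReal_le_ofReal (powerSum_mul_le_powerSum hl1 hl0 (by ring) hp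
          (div_neg_of_neg_of_pos hr hpos) hX hY)).trans ?_
        refine hself (fun k => powerSum (1 - l) l (r / (k * r + 1))) (fun k hk =>
          scaleMono_powerSum hl1 hl0 (div_ne_zero hr.ne (hkr k hk).ne')) ?_ (by simpa using hS0)
        intro k hk
        refine holderStep_powerSum_div hl1 hl0 hr.ne k (hkr k hk) ?_
        rcases (Nat.succ_le_of_lt hk).lt_or_eq with hk | hk
        · exact hkr _ hk
        · rwa [← hk] at hpos
    · have : alphaMean l (lpExponent n p ((0 : ℝ) : EReal)) X Y = X ^ (1 - l) * Y ^ l := by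
        rw [lpExponent_coe, if_neg (by simp), alphaMean, if_pos (by simp)]
      rw [this]
      exact hself (fun _ a b => a ^ (1 - l) * b ^ l)
        (fun _ _ => scaleMono_rpow_mul_rpow hl0.le hl.2.le)
        (fun _ _ => holderStep_rpow_mul_rpow hl0.le hl.2.le)
        (fun x hx y hy hfx hgy => hfgh_zero rfl x hx y hy (mul_pos hfx hgy))
    · have hpos : ∀ k : ℕ, 0 < k * r + 1 := fun k => by positivity
      rw [lpExponent_coe, if_neg (hpos n).ne',
        alphaMean_coe (div_ne_zero (mul_ne_zero (by linarith) hr.ne') (hpos n).ne') hXY,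
        mul_div_assoc]
      -- For positive β = r/(nr + 1) the mean of exponent pβ is at least that of exponent β, so m =
      -- l would give too little; m is fitted to X and Y before the chain is run.
      obtain ⟨m, hm, hmeq⟩ := exists_powerSum_lpCoeff_eq (b := r / (n * r + 1)) hp hl hX hY
      rw [← hmeq]
      have ht : 0 < lpCoeffLeft p l m := lpCoeffLeft_pos hl.2 hm.2
      have hs : 0 < lpCoeffRight p l m := lpCoeffRight_pos hl0 hm.1
      refine main m hm (fun k => powerSum (lpCoeffLeft p l m) (lpCoeffRight p l m)
        (r / (k * r + 1))) (fun k hk => scaleMono_powerSum ht hs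
          (div_ne_zero hr.ne' (hpos k).ne')) (fun k hk =>
            holderStep_powerSum_div ht hs hr.ne' k (hpos k) (hpos _)) ?_
      intro x hx y hy hfx hgy
      have := hfgh (by exact_mod_cast hr.ne') x hx y hy (mul_pos hfx hgy) m ⟨hm.1.le, hm.2.le⟩
      rw [alphaSum_coe r (mul_pos hfx hgy).ne'] at this
      simpa using this
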